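/- Let $(S,+)$ be a commutative semigroup with neutral element $0$, let $E$ be a complex Banach lattice (the complexification of a real Banach lattice, with norm $\|z\|=\|\,|z|\,\|$), and let $T\colon S\to\mathscr L(E)$ be a positive bounded representation, i.e. $T_0=\mathrm{id}_E$ and $T_{s+t}=T_sT_t$ for all $s,t\in S$, each $T_s$ is a positive operator, and $\sup_{s\in S}\|T_s\|<\infty$. Let $E'$ be the dual Banach space of $E$ with the dual order, and let $T'\colon S\to\mathscr L(E')$, $s\mapsto T_s'$, be the dual representation. Then there are a closed linear subspace $F\subseteq E'$ that is invariant under $T'_s$ for every $s\in S$, and a norm $\|\cdot\|_F$ on $F$ equivalent to the norm induced by $E'$, such that (i) $F$ is a (complex) Banach lattice with respect to the order inherited from $E'$ and the norm $\|\cdot\|_F$; (ii) for every unitary semigroup character $\chi$, i.e. every map $\chi\colon S\to\mathbb T=\{z\in\mathbb C: |z|=1\}$ with $\chi(0)=1$ and $\chi(s+t)=\chi(s)\chi(t)$ for all $s,t \in S$, the eigenspace $\ker(\chi-T')=\{x'\in E' : T_s'x'=\chi(s)x' \text{ for all } s\in S\}$ is contained in $F$; (iii) the restriction $T'|_F\colon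 s\mapsto T'_s|_F$ is a bounded representation of $S$ on $F$, and each $T'_s|_F$ is a lattice isomorphism of $F$. -/

import Mathlib

open Filter Topology

/-- The real part `E_ℝ = E₊ - E₊` of a complex vector space ordered by the positive cone `C = E₊`. -/
def coneReal {V : Type*} [AddCommGroup V] (C : Set V) : Set V :=
  {x | ∃ a ∈ C, ∃ b ∈ C, x = a - b}

/-- `m` is the supremum of `A` for the order `x ≤ y ↔ y - x ∈ C` given by the positive cone `C`. -/
def IsConeSup {V : Type*} [AddCommGroup V] (C : Set V) (A : Set V) (m : V) : Prop :=
  (∀ a ∈ A, m - a ∈ C) ∧ ∀ u, (∀ a ∈ A, u - a ∈ C) → u - m ∈ C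

/-- `m` is the modulus `|z| = sup_θ ((cos θ) x + (sin θ) y)` of `z = x + i y`, with `x`, `y` real. -/
def IsModulus {V : Type*} [AddCommGroup V] [Module ℂ V] (C : Set V) (z m : V) : Prop :=
  ∃ x ∈ coneReal C, ∃ y ∈ coneReal C, z = x + Complex.I • y ∧
    IsConeSup C
      (Set.range fun θ : ℝ => ((Real.cos θ : ℝ) : ℂ) • x + ((Real.sin θ : ℝ) : ℂ) • y) m

/-- The complex vector space `V` with positive cone `C` (i.e. the order `x ≤ y ↔ y - x ∈ C`) and
norm `N` is a (complex) Banach lattice: it is the complexification `V_ℝ ⊕ i V_ℝ` of its real part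
`V_ℝ = C - C`, which is a vector lattice, every `z` has a modulus `|z|`, the norm satisfies
`‖z‖ = ‖|z|‖`, is monotone on the positive cone, and is complete.

(Since `|x| = x ⊔ (-x)` for real `x`, the restriction of `N` to `V_ℝ` is a complete lattice norm,
so `V` is the complexification of the real Banach lattice `V_ℝ` with its usual norm.) -/
structure IsComplexBanachLattice {V : Type*} [AddCommGroup V] [Module ℂ V]
    (C : Set V) (N : Seminorm ℂ V) : Prop where
  zero_mem : (0 : V) ∈ C
  add_mem : ∀ x ∈ C, ∀ y ∈ C, x + y ∈ C
  smul_mem : ∀ r : ℝ, 0 ≤ r → ∀ x ∈ C, (r : ℂ) • x ∈ C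
  eq_zero_of_neg_mem : ∀ x ∈ C, -x ∈ C → x = 0
  exists_decomp : ∀ z : V, ∃ x ∈ coneReal C, ∃ y ∈ coneReal C, z = x + Complex.I • y
  eq_zero_of_I_smul : ∀ x ∈ coneReal C, Complex.I • x ∈ coneReal C → x = 0
  exists_sup : ∀ x ∈ coneReal C, ∀ y ∈ coneReal C, ∃ s, IsConeSup C {x, y} s
  exists_modulus : ∀ z : V, ∃ m, IsModulus C z m
  norm_modulus : ∀ z m : V, IsModulus C z m → N m = N z
  norm_mono : ∀ x ∈ C, ∀ y, y - x ∈ C → N x ≤ N y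
  norm_definite : ∀ x : V, N x = 0 → x = 0
  complete : ∀ u : ℕ → V,
    (∀ ε : ℝ, 0 < ε → ∃ n₀ : ℕ, ∀ m ≥ n₀, ∀ n ≥ n₀, N (u m - u n) < ε) →
      ∃ v : V, Tendsto (fun n => N (u n - v)) atTop (𝓝 0)

/-- A lattice homomorphism: a linear map with `L |z| = |L z|` for all `z`. -/
def IsLatticeHomomorphism {V : Type*} [AddCommGroup V] [Module ℂ V] (C : Set V)
    (L : V →ₗ[ℂ] V) : Prop :=
  ∀ z m : V, IsModulus C z m → IsModulus C (L z) (L m)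

/-- A lattice isomorphism: a bijective lattice homomorphism whose inverse is one, too. -/
def IsLatticeIsomorphism {V : Type*} [AddCommGroup V] [Module ℂ V] (C : Set V)
    (L : V →ₗ[ℂ] V) : Prop :=
  ∃ R : V →ₗ[ℂ] V, L ∘ₗ R = LinearMap.id ∧ R ∘ₗ L = LinearMap.id ∧
    IsLatticeHomomorphism C L ∧ IsLatticeHomomorphism C R

/-- The dual cone: `φ ≥ 0` iff `φ x ∈ [0, ∞)` for all `x ≥ 0`. -/
def dualCone {E : Type*} [NormedAddCommGroup E] [NormedSpace ℂ E] (C : Set E) :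
    Set (StrongDual ℂ E) :=
  {φ | ∀ x ∈ C, 0 ≤ (φ x).re ∧ (φ x).im = 0}

/-- The positive cone of a subspace for the inherited order. -/
def inheritedCone {V : Type*} [AddCommGroup V] [Module ℂ V] (C : Set V) (F : Submodule ℂ V) :
    Set F :=
  {x | (x : V) ∈ C}

/-- Representations of the additive monoid `S` in `A`: maps with `T (s + t) = T s * T t` and
`T 0 = 1`. -/
abbrev SemigroupRep (S : Type*) [AddCommMonoid S] (A : Type*) [Monoid A] := AddChar S A

/-- The dual representation `T'`, `T'_s φ = φ ∘ T_s`. -/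
noncomputable def dualRep {S : Type*} [AddCommMonoid S] {E : Type*} [NormedAddCommGroup E] [NormedSpace ℂ E]
    (T : SemigroupRep S (E →L[ℂ] E)) :
    SemigroupRep S (StrongDual ℂ E →L[ℂ] StrongDual ℂ E) where
  toFun s := ContinuousLinearMap.precomp ℂ (T s)
  map_zero_eq_one' := by
    ext φ x
    simp
  map_add_eq_mul' s t := by
    ext φ x
    rw [add_comm, AddChar.map_add_eq_mul]
    rfl

/-- The restriction of a representation to an invariant subspace. -/
noncomputable def restrictRep {S : Type*} [AddCommMonoid S] {V : Type*} [NormedAddCommGroup V]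
    [NormedSpace ℂ V] (T : SemigroupRep S (V →L[ℂ] V)) (F : Submodule ℂ V)
    (hF : ∀ s, ∀ x ∈ F, T s x ∈ F) : SemigroupRep S (Module.End ℂ F) where
  toFun s := (T s : V →ₗ[ℂ] V).restrict (hF s)
  map_zero_eq_one' := by
    ext x
    simp
  map_add_eq_mul' s t := by
    ext x
    simp [AddChar.map_add_eq_mul]

/-- The eigenspace `ker (χ - T) = {x | T_s x = χ(s) x for all s}`. -/
def eigenspaceRep {S : Type*} [AddCommMonoid S] {V : Type*} [NormedAddCommGroup V]
    [NormedSpace ℂ V] (T : SemigroupRep S (V →L[ℂ] V)) (χ : AddChar S Circle) : Set V :=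
  {x | ∀ s, T s x = (χ s : ℂ) • x}

/-! The Stone–Čech semigroup `βS` has an idempotent `p` in `⋂ₛ (s + βS)`: this set is closed,
nonempty because `S` is commutative, and a subsemigroup, so Ellis' lemma applies
(`exists_idempotent_tail_ultrafilter`). Let `P` be the pointwise weak* limit of `T'` along `p`. It
is a bounded positive operator commuting with `T'`, and `P² = P` because `p` is idempotent. The
space sought is `F = ran P`. If `φ` is an eigenvector for `χ`, then `Pφ = cφ` with `|c| = 1`, and
`P² = P` forces `Pφ = φ`. For each `s` write `p = s + r`; the limit `Q` along `r` satisfies `Q T'_s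
= T'_s Q = P`. Thus `T'_s` has the positive inverse `PQ` on `F`, and a positive bijection with
positive inverse preserves moduli.

The order structure of `F` comes from that of `E'`: the Riesz–Kantorovich formula supplies suprema
in `E'`, and a supremum in `F` is `P` of the supremum in `E'`. As `F` need not be a sublattice, its
norm is the size of the modulus formed in `F`. `norm_le_coneNorm` and `exists_isModulus_fixedSpace`
give the two halves of the norm equivalence, with no attempt at sharp constants. -/

/-- The order part of a complex Banach lattice: a complex vector space ordered by a cone that is the
complexification of a vector lattice in which moduli exist. -/
structure IsComplexVectorLattice {V : Type*} [AddCommGroup V] [Module ℂ V] (C : Set V) : Prop where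
  zero_mem : (0 : V) ∈ C
  add_mem : ∀ x ∈ C, ∀ y ∈ C, x + y ∈ C
  smul_mem : ∀ r : ℝ, 0 ≤ r → ∀ x ∈ C, (r : ℂ) • x ∈ C
  eq_zero_of_neg_mem : ∀ x ∈ C, -x ∈ C → x = 0
  exists_decomp : ∀ z : V, ∃ x ∈ coneReal C, ∃ y ∈ coneReal C, z = x + Complex.I • y
  eq_zero_of_I_smul : ∀ x ∈ coneReal C, Complex.I • x ∈ coneReal C → x = 0
  exists_sup : ∀ x ∈ coneReal C, ∀ y ∈ coneReal C, ∃ s, IsConeSup C {x, y} s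
  exists_modulus : ∀ z : V, ∃ m, IsModulus C z m

theorem IsComplexBanachLattice.isComplexVectorLattice {V : Type*} [AddCommGroup V] [Module ℂ V]
    {C : Set V} {N : Seminorm ℂ V} (h : IsComplexBanachLattice C N) : IsComplexVectorLattice C :=
  ⟨h.zero_mem, h.add_mem, h.smul_mem, h.eq_zero_of_neg_mem, h.exists_decomp, h.eq_zero_of_I_smul,
    h.exists_sup, h.exists_modulus⟩

/-! ### Moduli, Riesz decomposition and linear extension in complex vector lattices. -/

namespace IsComplexVectorLattice

variable {V : Type*} [AddCommGroup V] [Module ℂ V] {C : Set V}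

theorem mem_coneReal (h : IsComplexVectorLattice C) {x : V} (hx : x ∈ C) : x ∈ coneReal C :=
  ⟨x, hx, 0, h.zero_mem, by simp⟩

theorem coneReal_add (h : IsComplexVectorLattice C) {x y : V} (hx : x ∈ coneReal C)
    (hy : y ∈ coneReal C) : x + y ∈ coneReal C := by
  obtain ⟨a, ha, b, hb, rfl⟩ := hx
  obtain ⟨c, hc, d, hd, rfl⟩ := hy
  exact ⟨a + c, h.add_mem _ ha _ hc, b + d, h.add_mem _ hb _ hd, by abel⟩

theorem coneReal_smul (h : IsComplexVectorLattice C) (r : ℝ) {x : V} (hx : x ∈ coneReal C) :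
    (r : ℂ) • x ∈ coneReal C := by
  obtain ⟨a, ha, b, hb, rfl⟩ := hx
  rcases le_total 0 r with hr | hr
  · exact ⟨_, h.smul_mem r hr a ha, _, h.smul_mem r hr b hb, by module⟩
  · exact ⟨_, h.smul_mem (-r) (by linarith) b hb, _, h.smul_mem (-r) (by linarith) a ha, by
      push_cast; module⟩

theorem coneReal_sub (h : IsComplexVectorLattice C) {x y : V} (hx : x ∈ coneReal C)
    (hy : y ∈ coneReal C) : x - y ∈ coneReal C := by
  have := h.coneReal_add hx (h.coneReal_smul (-1) hy)
  simpa [sub_eq_add_neg] using this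

theorem decomp_unique (h : IsComplexVectorLattice C) {x y x' y' : V} (hx : x ∈ coneReal C)
    (hy : y ∈ coneReal C) (hx' : x' ∈ coneReal C) (hy' : y' ∈ coneReal C)
    (e : x + Complex.I • y = x' + Complex.I • y') : x = x' ∧ y = y' := by
  have e2 : Complex.I • (y - y') = x' - x := by
    rw [smul_sub, sub_eq_sub_iff_add_eq_add, add_comm, e]
  have hy0 : y = y' :=
    sub_eq_zero.1 (h.eq_zero_of_I_smul _ (h.coneReal_sub hy hy') (e2 ▸ h.coneReal_sub hx' hx))
  subst hy0
  exact ⟨by simpa using e, rfl⟩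

theorem isConeSup_unique (h : IsComplexVectorLattice C) {A : Set V} {m m' : V}
    (hm : IsConeSup C A m) (hm' : IsConeSup C A m') : m = m' :=
  sub_eq_zero.1 (h.eq_zero_of_neg_mem _ (hm'.2 m hm.1) (by simpa using hm.2 m' hm'.1))

theorem isModulus_iff (h : IsComplexVectorLattice C) {x y m : V} (hx : x ∈ coneReal C)
    (hy : y ∈ coneReal C) :
    IsModulus C (x + Complex.I • y) m ↔ IsConeSup C
      (Set.range fun θ : ℝ => ((Real.cos θ : ℝ) : ℂ) • x + ((Real.sin θ : ℝ) : ℂ) • y) m := by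
  constructor
  · rintro ⟨x', hx', y', hy', e, hm⟩
    obtain ⟨rfl, rfl⟩ := h.decomp_unique hx hy hx' hy' e
    exact hm
  · exact fun hm => ⟨x, hx, y, hy, rfl, hm⟩

theorem isModulus_unique (h : IsComplexVectorLattice C) {z m m' : V} (hm : IsModulus C z m)
    (hm' : IsModulus C z m') : m = m' := by
  obtain ⟨x, hx, y, hy, rfl, hs⟩ := hm
  exact h.isConeSup_unique hs ((h.isModulus_iff hx hy).1 hm')

theorem half_mem (h : IsComplexVectorLattice C) {m : V} (hm : m + m ∈ C) : m ∈ C := by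
  have := h.smul_mem (1 / 2) (by norm_num) _ hm
  convert this using 1
  push_cast
  module

/-- The angles `0, π, ±π/2` give the four bounds, and `2m = (m - x) + (m + x)` gives positivity of
`m`. -/
theorem exists_re_im_le_of_isModulus (h : IsComplexVectorLattice C) {z m : V}
    (hm : IsModulus C z m) : ∃ x y, z = x + Complex.I • y ∧ m ∈ C ∧
      m - x ∈ C ∧ m + x ∈ C ∧ m - y ∈ C ∧ m + y ∈ C := by
  obtain ⟨x, hx, y, hy, rfl, hs⟩ := hm
  have h1 := hs.1 _ ⟨0, rfl⟩
  have h2 := hs.1 _ ⟨Real.pi, rfl⟩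
  have h3 := hs.1 _ ⟨Real.pi / 2, rfl⟩
  have h4 := hs.1 _ ⟨-(Real.pi / 2), rfl⟩
  simp only [Real.cos_zero, Real.sin_zero, Real.cos_pi, Real.sin_pi, Real.cos_pi_div_two,
    Real.sin_pi_div_two, Real.cos_neg, Real.sin_neg, Complex.ofReal_one, Complex.ofReal_zero,
    Complex.ofReal_neg, neg_smul, one_smul, zero_smul, add_zero, zero_add, sub_neg_eq_add]
    at h1 h2 h3 h4
  refine ⟨x, y, rfl, h.half_mem ?_, h1, h2, h3, h4⟩
  have := h.add_mem _ h1 _ h2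
  convert this using 1
  abel

theorem isModulus_mem (h : IsComplexVectorLattice C) {z m : V} (hm : IsModulus C z m) : m ∈ C := by
  obtain ⟨x, y, -, hm, -⟩ := h.exists_re_im_le_of_isModulus hm
  exact hm

theorem isModulus_self (h : IsComplexVectorLattice C) {x : V} (hx : x ∈ C) : IsModulus C x x := by
  refine ⟨x, h.mem_coneReal hx, 0, h.mem_coneReal h.zero_mem, by simp, ?_, ?_⟩
  · rintro _ ⟨θ, rfl⟩
    have := h.smul_mem (1 - Real.cos θ) (by linarith [Real.cos_le_one θ]) x hx
    convert this using 1
    push_cast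
    module
  · intro u hu
    simpa using hu _ ⟨0, rfl⟩

/-- With `c = r e^{iα}`, multiplication by `c` turns the member at angle `θ - α` of the family for
`z`, scaled by `r`, into the member at angle `θ`. -/
theorem isModulus_smul_le (h : IsComplexVectorLattice C) {z m m' : V} (c : ℂ)
    (hm : IsModulus C z m) (hm' : IsModulus C (c • z) m') : ((‖c‖ : ℝ) : ℂ) • m - m' ∈ C := by
  obtain ⟨x, hx, y, hy, rfl, hs⟩ := hm
  set r := ‖c‖
  set α := c.arg
  have hc : c = (r : ℂ) * ((Real.cos α : ℝ) + (Real.sin α : ℝ) * Complex.I) := by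
    rw [Complex.ofReal_cos, Complex.ofReal_sin]
    exact (Complex.norm_mul_cos_add_sin_mul_I c).symm
  have hx' : ((r * Real.cos α : ℝ) : ℂ) • x - ((r * Real.sin α : ℝ) : ℂ) • y ∈ coneReal C :=
    h.coneReal_sub (h.coneReal_smul _ hx) (h.coneReal_smul _ hy)
  have hy' : ((r * Real.sin α : ℝ) : ℂ) • x + ((r * Real.cos α : ℝ) : ℂ) • y ∈ coneReal C :=
    h.coneReal_add (h.coneReal_smul _ hx) (h.coneReal_smul _ hy)
  have e : c • (x + Complex.I • y) =
      (((r * Real.cos α : ℝ) : ℂ) • x - ((r * Real.sin α : ℝ) : ℂ) • y) + Complex.I •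
        (((r * Real.sin α : ℝ) : ℂ) • x + ((r * Real.cos α : ℝ) : ℂ) • y) := by
    have hI : ((r * Real.sin α : ℝ) : ℂ) • y =
        -((r * Real.sin α * (Complex.I * Complex.I) : ℂ) • y) := by
      rw [Complex.I_mul_I]; push_cast; module
    rw [hI]
    nth_rewrite 1 [hc]
    push_cast
    module
  rw [e, h.isModulus_iff hx' hy'] at hm'
  refine hm'.2 _ ?_
  rintro _ ⟨θ, rfl⟩
  have := h.smul_mem r (norm_nonneg c) _ (hs.1 _ ⟨θ - α, rfl⟩)
  convert this using 1
  simp only [Real.cos_sub, Real.sin_sub]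
  push_cast
  module

theorem isModulus_add_le (h : IsComplexVectorLattice C) {z w m n k : V}
    (hm : IsModulus C z m) (hn : IsModulus C w n) (hk : IsModulus C (z + w) k) :
    m + n - k ∈ C := by
  obtain ⟨x, hx, y, hy, rfl, hs⟩ := hm
  obtain ⟨x', hx', y', hy', rfl, hs'⟩ := hn
  have e : x + Complex.I • y + (x' + Complex.I • y') = x + x' + Complex.I • (y + y') := by module
  rw [e, h.isModulus_iff (h.coneReal_add hx hx') (h.coneReal_add hy hy')] at hk
  refine hk.2 _ ?_
  rintro _ ⟨θ, rfl⟩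
  have := h.add_mem _ (hs.1 _ ⟨θ, rfl⟩) _ (hs'.1 _ ⟨θ, rfl⟩)
  convert this using 1
  module

/-- The Riesz decomposition property. -/
theorem riesz_decomposition (h : IsComplexVectorLattice C) {u x y : V} (hu : u ∈ C) (hx : x ∈ C)
    (hy : y ∈ C) (hle : x + y - u ∈ C) :
    ∃ u₁ ∈ C, ∃ u₂ ∈ C, u = u₁ + u₂ ∧ x - u₁ ∈ C ∧ y - u₂ ∈ C := by
  obtain ⟨s, hs⟩ := h.exists_sup u (h.mem_coneReal hu) x (h.mem_coneReal hx)
  -- These are `u ∧ x` and `(u - x)⁺`, since `s = u ∨ x`.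
  refine ⟨u + x - s, hs.2 _ ?_, s - x, hs.1 _ (by simp), by abel, ?_, ?_⟩
  · rintro a (rfl | rfl) <;> simpa
  · convert hs.1 u (by simp) using 1
    abel
  · have := hs.2 (x + y) (by rintro a (rfl | rfl) <;> simpa)
    convert this using 1
    abel

/-- Mutually inverse positive linear maps preserve moduli. -/
theorem isLatticeHomomorphism_of_inverse {L R : V →ₗ[ℂ] V}
    (hRL : ∀ x, R (L x) = x) (hLR : ∀ x, L (R x) = x)
    (hL : ∀ x ∈ C, L x ∈ C) (hR : ∀ x ∈ C, R x ∈ C) : IsLatticeHomomorphism C L := by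
  have hreal : ∀ x ∈ coneReal C, L x ∈ coneReal C := by
    rintro _ ⟨a, ha, b, hb, rfl⟩
    exact ⟨_, hL a ha, _, hL b hb, map_sub _ _ _⟩
  rintro _ m ⟨x, hx, y, hy, rfl, hs⟩
  refine ⟨L x, hreal x hx, L y, hreal y hy, by simp, ?_, ?_⟩
  · rintro _ ⟨θ, rfl⟩
    simpa using hL _ (hs.1 _ ⟨θ, rfl⟩)
  · intro u hu
    have := hs.2 (R u) ?_
    · simpa [hLR] using hL _ this
    · rintro _ ⟨θ, rfl⟩
      simpa [hRL] using hR _ (hu _ ⟨θ, rfl⟩)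

theorem exists_four_decomp (h : IsComplexVectorLattice C) (z : V) :
    ∃ a ∈ C, ∃ b ∈ C, ∃ c ∈ C, ∃ d ∈ C, z = (a - b) + Complex.I • (c - d) := by
  obtain ⟨x, ⟨a, ha, b, hb, rfl⟩, y, ⟨c, hc, d, hd, rfl⟩, rfl⟩ := h.exists_decomp z
  exact ⟨a, ha, b, hb, c, hc, d, hd, rfl⟩

/-- An additive, positively homogeneous function on the cone extends to a complex linear form. -/
theorem exists_linear_extension (h : IsComplexVectorLattice C) (p : V → ℝ)
    (hadd : ∀ x ∈ C, ∀ y ∈ C, p (x + y) = p x + p y)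
    (hsmul : ∀ r : ℝ, 0 ≤ r → ∀ x ∈ C, p ((r : ℂ) • x) = r * p x) :
    ∃ f : V →ₗ[ℂ] ℂ, ∀ x ∈ C, f x = p x := by
  choose a ha b hb c hc d hd hz using h.exists_four_decomp
  let g : V → ℂ := fun z => (p (a z) - p (b z)) + Complex.I * (p (c z) - p (d z))
  -- The value does not depend on the chosen decomposition; this makes additivity and homogeneity
  -- computations.
  have key : ∀ a' ∈ C, ∀ b' ∈ C, ∀ c' ∈ C, ∀ d' ∈ C,
      g ((a' - b') + Complex.I • (c' - d')) = (p a' - p b') + Complex.I * (p c' - p d') := by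
    intro a' ha' b' hb' c' hc' d' hd'
    set z := (a' - b') + Complex.I • (c' - d') with hzdef
    obtain ⟨e1, e2⟩ := h.decomp_unique (x := a z - b z) (y := c z - d z) (x' := a' - b')
      (y' := c' - d') ⟨_, ha z, _, hb z, rfl⟩ ⟨_, hc z, _, hd z, rfl⟩ ⟨_, ha', _, hb', rfl⟩
      ⟨_, hc', _, hd', rfl⟩ ((hz z).symm.trans hzdef)
    rw [sub_eq_sub_iff_add_eq_add] at e1 e2
    have p1 := congrArg p e1
    have p2 := congrArg p e2
    rw [hadd _ (ha z) _ hb', hadd _ ha' _ (hb z)] at p1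
    rw [hadd _ (hc z) _ hd', hadd _ hc' _ (hd z)] at p2
    have q1 : (p (a z) : ℂ) - p (b z) = p a' - p b' := by
      rw [sub_eq_sub_iff_add_eq_add]; exact_mod_cast p1
    have q2 : (p (c z) : ℂ) - p (d z) = p c' - p d' := by
      rw [sub_eq_sub_iff_add_eq_add]; exact_mod_cast p2
    simp only [g, q1, q2]
  have comb : ∀ r₁ r₂ r₃ r₄ : ℝ, 0 ≤ r₁ → 0 ≤ r₂ → 0 ≤ r₃ → 0 ≤ r₄ →
      ∀ x₁ ∈ C, ∀ x₂ ∈ C, ∀ x₃ ∈ C, ∀ x₄ ∈ C,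
      (r₁ : ℂ) • x₁ + (r₂ : ℂ) • x₂ + (r₃ : ℂ) • x₃ + (r₄ : ℂ) • x₄ ∈ C ∧
      p ((r₁ : ℂ) • x₁ + (r₂ : ℂ) • x₂ + (r₃ : ℂ) • x₃ + (r₄ : ℂ) • x₄) =
        r₁ * p x₁ + r₂ * p x₂ + r₃ * p x₃ + r₄ * p x₄ := by
    intro r₁ r₂ r₃ r₄ h₁ h₂ h₃ h₄ x₁ m₁ x₂ m₂ x₃ m₃ x₄ m₄
    have n₁ := h.smul_mem _ h₁ _ m₁
    have n₂ := h.smul_mem _ h₂ _ m₂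
    have n₃ := h.smul_mem _ h₃ _ m₃
    have n₄ := h.smul_mem _ h₄ _ m₄
    have n₁₂ := h.add_mem _ n₁ _ n₂
    have n₁₃ := h.add_mem _ n₁₂ _ n₃
    refine ⟨h.add_mem _ n₁₃ _ n₄, ?_⟩
    rw [hadd _ n₁₃ _ n₄, hadd _ n₁₂ _ n₃, hadd _ n₁ _ n₂, hsmul _ h₁ _ m₁, hsmul _ h₂ _ m₂,
      hsmul _ h₃ _ m₃, hsmul _ h₄ _ m₄]
  have gadd : ∀ z w, g (z + w) = g z + g w := by
    intro z w
    have e : z + w = ((a z + a w) - (b z + b w)) +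
        Complex.I • ((c z + c w) - (d z + d w)) := by
      nth_rewrite 1 [hz z, hz w]
      module
    rw [e, key _ (h.add_mem _ (ha z) _ (ha w)) _ (h.add_mem _ (hb z) _ (hb w))
      _ (h.add_mem _ (hc z) _ (hc w)) _ (h.add_mem _ (hd z) _ (hd w)),
      hadd _ (ha z) _ (ha w), hadd _ (hb z) _ (hb w), hadd _ (hc z) _ (hc w),
      hadd _ (hd z) _ (hd w)]
    simp only [g]
    push_cast
    ring
  -- Only nonnegative scalars pass through `p`, so `k` is split into four nonnegative parts and `k •
  -- z` regrouped into four cone elements.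
  have gsmul : ∀ (k : ℂ) z, g (k • z) = k * g z := by
    intro k z
    obtain ⟨s₁, hs₁, s₂, hs₂, hs⟩ : ∃ s₁ : ℝ, 0 ≤ s₁ ∧ ∃ s₂ : ℝ, 0 ≤ s₂ ∧ k.re = s₁ - s₂ :=
      ⟨_, posPart_nonneg k.re, _, negPart_nonneg k.re, (posPart_sub_negPart _).symm⟩
    obtain ⟨t₁, ht₁, t₂, ht₂, ht⟩ : ∃ s₁ : ℝ, 0 ≤ s₁ ∧ ∃ s₂ : ℝ, 0 ≤ s₂ ∧ k.im = s₁ - s₂ :=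
      ⟨_, posPart_nonneg k.im, _, negPart_nonneg k.im, (posPart_sub_negPart _).symm⟩
    have hk : k = ((s₁ : ℂ) - s₂) + (t₁ - t₂) * Complex.I := by
      rw [← Complex.re_add_im k, hs, ht]
      push_cast
      ring
    obtain ⟨m1, p1⟩ := comb s₁ s₂ t₁ t₂ hs₁ hs₂ ht₁ ht₂ _ (ha z) _ (hb z) _ (hd z) _ (hc z)
    obtain ⟨m2, p2⟩ := comb s₁ s₂ t₁ t₂ hs₁ hs₂ ht₁ ht₂ _ (hb z) _ (ha z) _ (hc z) _ (hd z)
    obtain ⟨m3, p3⟩ := comb s₁ s₂ t₁ t₂ hs₁ hs₂ ht₁ ht₂ _ (hc z) _ (hd z) _ (ha z) _ (hb z)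
    obtain ⟨m4, p4⟩ := comb s₁ s₂ t₁ t₂ hs₁ hs₂ ht₁ ht₂ _ (hd z) _ (hc z) _ (hb z) _ (ha z)
    have k4 := key _ m1 _ m2 _ m3 _ m4
    rw [p1, p2, p3, p4] at k4
    have hI : ∀ v : V, Complex.I • Complex.I • v = -v := fun v => by
      rw [smul_smul, Complex.I_mul_I, neg_one_smul]
    have e : k • z = ((s₁ : ℂ) • a z + (s₂ : ℂ) • b z + (t₁ : ℂ) • d z + (t₂ : ℂ) • c z -
        ((s₁ : ℂ) • b z + (s₂ : ℂ) • a z + (t₁ : ℂ) • c z + (t₂ : ℂ) • d z)) + Complex.I •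
        ((s₁ : ℂ) • c z + (s₂ : ℂ) • d z + (t₁ : ℂ) • a z + (t₂ : ℂ) • b z -
        ((s₁ : ℂ) • d z + (s₂ : ℂ) • c z + (t₁ : ℂ) • b z + (t₂ : ℂ) • a z)) := by
      have e1 : k • z = ((s₁ : ℂ) - s₂) • (a z - b z) +
          Complex.I • (((s₁ : ℂ) - s₂) • (c z - d z) + ((t₁ : ℂ) - t₂) • (a z - b z)) +
          ((t₁ : ℂ) - t₂) • (Complex.I • Complex.I • (c z - d z)) := by
        nth_rewrite 1 [hz z]
        rw [hk]
        module
      rw [e1, hI]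
      module
    rw [e, k4, hk]
    simp only [g]
    push_cast
    linear_combination (-((t₁ : ℂ) - t₂) * ((p (c z) : ℂ) - p (d z))) * Complex.I_sq
  refine ⟨⟨⟨g, gadd⟩, gsmul⟩, fun x hx => ?_⟩
  have p0 : p 0 = 0 := by
    have := hadd 0 h.zero_mem 0 h.zero_mem
    simpa using this
  have := key x hx 0 h.zero_mem 0 h.zero_mem 0 h.zero_mem
  simpa [p0] using this

end IsComplexVectorLattice

/-! ### Order structure of the dual: the Riesz–Kantorovich formula. -/

section Dual

variable {E : Type*} [NormedAddCommGroup E] [NormedSpace ℂ E] {C : Set E}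

namespace IsComplexBanachLattice

theorem norm_le_norm (hE : IsComplexBanachLattice C (normSeminorm ℂ E)) {x y : E} (hx : x ∈ C)
    (hxy : y - x ∈ C) : ‖x‖ ≤ ‖y‖ :=
  hE.norm_mono x hx y hxy

theorem norm_add_le_two_mul (hE : IsComplexBanachLattice C (normSeminorm ℂ E)) {x w : E}
    (h₁ : x - w ∈ C) (h₂ : x + w ∈ C) : ‖x + w‖ ≤ 2 * ‖x‖ := by
  have := hE.norm_le_norm h₂ (y := x + x) (by convert h₁ using 1; abel)
  linarith [norm_add_le x x]

/-- Writing `w = (x + w) - x` as a difference of positive elements avoids the modulus of `w`, at the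
cost of a factor. -/
theorem norm_le_three_mul (hE : IsComplexBanachLattice C (normSeminorm ℂ E)) {x w : E}
    (h₁ : x - w ∈ C) (h₂ : x + w ∈ C) : ‖w‖ ≤ 3 * ‖x‖ := by
  have h := norm_sub_le (x + w) x
  rw [add_sub_cancel_left] at h
  linarith [hE.norm_add_le_two_mul h₁ h₂]

/-- A linear form bounded on the positive cone is bounded. -/
theorem norm_apply_le_of_cone (hE : IsComplexBanachLattice C (normSeminorm ℂ E)) (f : E →ₗ[ℂ] ℂ)
    {K : ℝ} (hK : 0 ≤ K) (hf : ∀ x ∈ C, ‖f x‖ ≤ K * ‖x‖) (z : E) : ‖f z‖ ≤ 6 * K * ‖z‖ := by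
  obtain ⟨m, hm⟩ := hE.exists_modulus z
  have hnorm : ‖m‖ = ‖z‖ := hE.norm_modulus z m hm
  obtain ⟨x, y, rfl, hmC, h1, h2, h3, h4⟩ :=
    hE.isComplexVectorLattice.exists_re_im_le_of_isModulus hm
  -- Shifting by the modulus `m` leaves only cone elements; the four terms contribute `2 + 1 + 2 + 1
  -- = 6`.
  have e : f (x + Complex.I • y) =
      (f (m + x) - f m) + Complex.I * (f (m + y) - f m) := by
    simp
  have n1 : ‖f (m + x)‖ ≤ K * (2 * ‖m‖) :=
    (hf _ h2).trans (mul_le_mul_of_nonneg_left (hE.norm_add_le_two_mul h1 h2) hK)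
  have n2 : ‖f (m + y)‖ ≤ K * (2 * ‖m‖) :=
    (hf _ h4).trans (mul_le_mul_of_nonneg_left (hE.norm_add_le_two_mul h3 h4) hK)
  have n3 := hf m hmC
  rw [← hnorm, e]
  calc _ ≤ ‖f (m + x) - f m‖ + ‖Complex.I * (f (m + y) - f m)‖ := norm_add_le _ _
    _ ≤ (‖f (m + x)‖ + ‖f m‖) + (‖f (m + y)‖ + ‖f m‖) := by
        rw [norm_mul, Complex.norm_I, one_mul]
        exact add_le_add (norm_sub_le _ _) (norm_sub_le _ _)
    _ ≤ _ := by linarith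

theorem opNorm_le_of_cone (hE : IsComplexBanachLattice C (normSeminorm ℂ E)) (φ : StrongDual ℂ E)
    {K : ℝ} (hK : 0 ≤ K) (hf : ∀ x ∈ C, ‖φ x‖ ≤ K * ‖x‖) : ‖φ‖ ≤ 6 * K :=
  φ.opNorm_le_bound (by positivity) (hE.norm_apply_le_of_cone (φ : E →ₗ[ℂ] ℂ) hK hf)

theorem exists_strongDual_extension (hE : IsComplexBanachLattice C (normSeminorm ℂ E)) (p : E → ℝ)
    (hadd : ∀ x ∈ C, ∀ y ∈ C, p (x + y) = p x + p y)
    (hsmul : ∀ r : ℝ, 0 ≤ r → ∀ x ∈ C, p ((r : ℂ) • x) = r * p x)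
    {K : ℝ} (hK : 0 ≤ K) (hp : ∀ x ∈ C, |p x| ≤ K * ‖x‖) :
    ∃ φ : StrongDual ℂ E, ∀ x ∈ C, φ x = p x := by
  obtain ⟨f, hf⟩ := hE.isComplexVectorLattice.exists_linear_extension p hadd hsmul
  refine ⟨f.mkContinuous (6 * K) (hE.norm_apply_le_of_cone f hK fun x hx => ?_), hf⟩
  rw [hf x hx, Complex.norm_real]
  exact hp x hx

theorem strongDual_ext (hE : IsComplexBanachLattice C (normSeminorm ℂ E)) {φ ψ : StrongDual ℂ E}
    (h : ∀ x ∈ C, φ x = ψ x) : φ = ψ := by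
  ext z
  obtain ⟨a, ha, b, hb, c, hc, d, hd, rfl⟩ := hE.isComplexVectorLattice.exists_four_decomp z
  simp [h a ha, h b hb, h c hc, h d hd]

end IsComplexBanachLattice

/-- `v = ∑ Re φᵢ(xᵢ)` for a decomposition `x = ∑ xᵢ` with `xᵢ ∈ C` and `φᵢ ∈ A`; the supremum of
these values is the Riesz–Kantorovich formula for `(sup A)(x)`. -/
inductive RieszSum (C : Set E) (A : Set (StrongDual ℂ E)) : E → ℝ → Prop
  | zero : RieszSum C A 0 0
  | cons {φ : StrongDual ℂ E} {u x : E} {v : ℝ} (hφ : φ ∈ A) (hu : u ∈ C)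
      (h : RieszSum C A x v) : RieszSum C A (u + x) ((φ u).re + v)

namespace RieszSum

variable {A : Set (StrongDual ℂ E)} {x y : E} {v w : ℝ}

theorem single {φ : StrongDual ℂ E} (hφ : φ ∈ A) (hx : x ∈ C) : RieszSum C A x (φ x).re := by
  simpa using cons hφ hx zero

theorem mem_cone (hC : IsComplexVectorLattice C) (h : RieszSum C A x v) : x ∈ C := by
  induction h with
  | zero => exact hC.zero_mem
  | cons _ hu _ ih => exact hC.add_mem _ hu _ ih

theorem append (hx : RieszSum C A x v) (hy : RieszSum C A y w) :
    RieszSum C A (x + y) (v + w) := by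
  induction hx with
  | zero => simpa using hy
  | cons hφ hu _ ih =>
    rw [add_assoc, add_assoc]
    exact cons hφ hu ih

theorem smul (hC : IsComplexVectorLattice C) {r : ℝ} (hr : 0 ≤ r) (hx : RieszSum C A x v) :
    RieszSum C A ((r : ℂ) • x) (r * v) := by
  induction hx with
  | zero => simpa using zero
  | @cons φ u _ _ hφ hu _ ih =>
    have := cons hφ (hC.smul_mem r hr _ hu) ih
    convert this using 1
    · rw [smul_add]
    · simp [mul_add]

/-- Riesz decomposition cuts each summand in turn along `x + y`. This yields subadditivity of the
Riesz–Kantorovich supremum in the argument, `append` the reverse. -/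
theorem split (hC : IsComplexVectorLattice C) {z : E} (h : RieszSum C A z v) :
    ∀ x ∈ C, ∀ y ∈ C, z = x + y →
      ∃ v₁ v₂, RieszSum C A x v₁ ∧ RieszSum C A y v₂ ∧ v = v₁ + v₂ := by
  induction h with
  | zero =>
    intro x hx y hy e
    have hx0 : x = 0 := hC.eq_zero_of_neg_mem x hx (by
      rwa [neg_eq_of_add_eq_zero_right e.symm])
    subst hx0
    obtain rfl : y = 0 := by simpa using e.symm
    exact ⟨0, 0, zero, zero, by simp⟩
  | @cons φ u z v hφ hu hz ih =>
    intro x hx y hy e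
    obtain ⟨u₁, hu₁, u₂, hu₂, rfl, h1, h2⟩ := hC.riesz_decomposition hu hx hy
      (by rw [← e, add_sub_cancel_left]; exact hz.mem_cone hC)
    obtain ⟨v₁, v₂, r₁, r₂, rfl⟩ := ih _ h1 _ h2 (by
      rw [sub_add_sub_comm, ← e, add_sub_cancel_left])
    refine ⟨_, _, add_sub_cancel u₁ x ▸ cons hφ hu₁ r₁, add_sub_cancel u₂ y ▸ cons hφ hu₂ r₂, ?_⟩
    simp only [map_add, Complex.add_re]
    ring

/-- A Riesz sum of combinations of `φ` and `ψ` with coefficients in `[-1, 1]` is given by two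
elements of the order interval `[-x, x]`. -/
theorem exists_eq_of_combination (hC : IsComplexVectorLattice C) {φ ψ : StrongDual ℂ E}
    (hA : ∀ χ ∈ A, ∃ c d : ℝ, |c| ≤ 1 ∧ |d| ≤ 1 ∧ χ = (c : ℂ) • φ + (d : ℂ) • ψ)
    (h : RieszSum C A x v) : ∃ w₁ w₂, x - w₁ ∈ C ∧ x + w₁ ∈ C ∧ x - w₂ ∈ C ∧ x + w₂ ∈ C ∧
      v = (φ w₁).re + (ψ w₂).re := by
  induction h with
  | zero => exact ⟨0, 0, by simp [hC.zero_mem]⟩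
  | @cons χ u x v hχ hu hx ih =>
    obtain ⟨w₁, w₂, h1, h2, h3, h4, rfl⟩ := ih
    obtain ⟨c, d, hc, hd, rfl⟩ := hA χ hχ
    have key : ∀ r : ℝ, |r| ≤ 1 → u - (r : ℂ) • u ∈ C ∧ u + (r : ℂ) • u ∈ C := by
      intro r hr
      obtain ⟨hr1, hr2⟩ := abs_le.1 hr
      constructor
      · convert hC.smul_mem (1 - r) (by linarith) u hu using 1
        push_cast
        module
      · convert hC.smul_mem (1 + r) (by linarith) u hu using 1
        push_cast
        module
    -- The coefficients are moved from the functionals to the summands: `w₁ = ∑ cᵢ uᵢ` and `w₂ = ∑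
    -- dᵢ uᵢ`.
    refine ⟨(c : ℂ) • u + w₁, (d : ℂ) • u + w₂, ?_, ?_, ?_, ?_, ?_⟩
    · rw [add_sub_add_comm]; exact hC.add_mem _ (key c hc).1 _ h1
    · rw [add_add_add_comm]; exact hC.add_mem _ (key c hc).2 _ h2
    · rw [add_sub_add_comm]; exact hC.add_mem _ (key d hd).1 _ h3
    · rw [add_add_add_comm]; exact hC.add_mem _ (key d hd).2 _ h4
    · simp
      ring

end RieszSum

namespace IsComplexBanachLattice

/-- Riesz–Kantorovich: a set of real functionals with bounded Riesz sums has a supremum. -/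
theorem exists_isConeSup_of_rieszSum_le (hE : IsComplexBanachLattice C (normSeminorm ℂ E))
    {A : Set (StrongDual ℂ E)} (hne : A.Nonempty) (hreal : ∀ φ ∈ A, ∀ x ∈ C, (φ x).im = 0)
    {K : ℝ} (hK : 0 ≤ K) (hb : ∀ x v, RieszSum C A x v → v ≤ K * ‖x‖) :
    ∃ m, IsConeSup (dualCone C) A m ∧ ∀ x ∈ C, (m x).re ≤ K * ‖x‖ := by
  have hC := hE.isComplexVectorLattice
  obtain ⟨φ₀, hφ₀⟩ := hne
  let p : E → ℝ := fun x => sSup {v | RieszSum C A x v}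
  have hbdd : ∀ x, BddAbove {v | RieszSum C A x v} := fun x => ⟨_, fun v hv => hb x v hv⟩
  have hle : ∀ {x v}, RieszSum C A x v → v ≤ p x := fun h => le_csSup (hbdd _) h
  have hpb : ∀ {x c}, x ∈ C → (∀ v, RieszSum C A x v → v ≤ c) → p x ≤ c := fun hx h =>
    csSup_le ⟨_, RieszSum.single hφ₀ hx⟩ h
  have hadd : ∀ x ∈ C, ∀ y ∈ C, p (x + y) = p x + p y := by
    intro x hx y hy
    refine le_antisymm (hpb (hC.add_mem _ hx _ hy) ?_) ?_
    · intro v hv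
      obtain ⟨v₁, v₂, h1, h2, rfl⟩ := hv.split hC x hx y hy rfl
      exact add_le_add (hle h1) (hle h2)
    · rw [← le_sub_iff_add_le]
      refine hpb hx fun v hv => ?_
      rw [le_sub_comm]
      refine hpb hy fun w hw => ?_
      rw [le_sub_iff_add_le, add_comm]
      exact hle (hv.append hw)
  have hsmul_le : ∀ r : ℝ, 0 < r → ∀ x ∈ C, p ((r : ℂ) • x) ≤ r * p x := by
    intro r hr x hx
    refine hpb (hC.smul_mem r hr.le x hx) fun v hv => ?_
    have := hle (hv.smul hC (inv_nonneg.2 hr.le))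
    rw [smul_smul, ← Complex.ofReal_mul, inv_mul_cancel₀ hr.ne', Complex.ofReal_one,
      one_smul] at this
    rwa [inv_mul_le_iff₀ hr] at this
  have hsmul : ∀ r : ℝ, 0 ≤ r → ∀ x ∈ C, p ((r : ℂ) • x) = r * p x := by
    intro r hr x hx
    rcases hr.eq_or_lt with rfl | hr
    · have := hadd 0 hC.zero_mem 0 hC.zero_mem
      simpa using this
    · refine le_antisymm (hsmul_le r hr x hx) ?_
      have := hsmul_le r⁻¹ (inv_pos.2 hr) _ (hC.smul_mem r hr.le x hx)
      rw [smul_smul, ← Complex.ofReal_mul, inv_mul_cancel₀ hr.ne', Complex.ofReal_one,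
        one_smul] at this
      rwa [le_inv_mul_iff₀ hr] at this
  -- The hypothesis bounds `p` only from above; the lower bound comes from the one-term sum with
  -- `φ₀`, hence the maximum.
  have hp : ∀ x ∈ C, |p x| ≤ max K ‖φ₀‖ * ‖x‖ := by
    intro x hx
    rw [abs_le]
    constructor
    · have h1 : -(‖φ₀‖ * ‖x‖) ≤ (φ₀ x).re :=
        (abs_le.1 ((Complex.abs_re_le_norm _).trans (φ₀.le_opNorm x))).1
      have h2 := hle (RieszSum.single hφ₀ hx)
      have h3 := mul_le_mul_of_nonneg_right (le_max_right K ‖φ₀‖) (norm_nonneg x)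
      linarith
    · exact (hpb hx (hb x)).trans
        (mul_le_mul_of_nonneg_right (le_max_left _ _) (norm_nonneg x))
  obtain ⟨m, hm⟩ := hE.exists_strongDual_extension p hadd hsmul (hK.trans (le_max_left _ ‖φ₀‖)) hp
  refine ⟨m, ⟨?_, ?_⟩, fun x hx => ?_⟩
  · intro φ hφ x hx
    have := hle (RieszSum.single hφ hx)
    simp [hm x hx, hreal φ hφ x hx, this]
  · intro u hu x hx
    have huv : ∀ x v, RieszSum C A x v → v ≤ (u x).re := by
      intro x v h
      induction h with
      | zero => simp
      | @cons φ y x v hφ hy _ ih =>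
        have := (hu φ hφ y hy).1
        simp only [sub_apply, Complex.sub_re] at this
        simp only [map_add, Complex.add_re]
        linarith
    have hu0 : (u x).im = 0 := by
      have := (hu φ₀ hφ₀ x hx).2
      simpa [hreal φ₀ hφ₀ x hx] using this
    simp [hm x hx, hu0, hpb hx (huv x)]
  · rw [hm x hx, Complex.ofReal_re]
    exact hpb hx (hb x)

/-- Sets of combinations of two real functionals with coefficients in `[-1, 1]` have suprema. -/
theorem exists_isConeSup_of_combination (hE : IsComplexBanachLattice C (normSeminorm ℂ E))
    {φ ψ : StrongDual ℂ E} (hφ : ∀ x ∈ C, (φ x).im = 0) (hψ : ∀ x ∈ C, (ψ x).im = 0)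
    {A : Set (StrongDual ℂ E)} (hne : A.Nonempty)
    (hA : ∀ χ ∈ A, ∃ c d : ℝ, |c| ≤ 1 ∧ |d| ≤ 1 ∧ χ = (c : ℂ) • φ + (d : ℂ) • ψ)
    {K : ℝ} (hK : 0 ≤ K) (h1 : ∀ w ∈ coneReal C, (φ w).re ≤ K * ‖w‖)
    (h2 : ∀ w ∈ coneReal C, (ψ w).re ≤ K * ‖w‖) :
    ∃ m, IsConeSup (dualCone C) A m ∧ ∀ x ∈ C, (m x).re ≤ 6 * K * ‖x‖ := by
  have hC := hE.isComplexVectorLattice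
  refine hE.exists_isConeSup_of_rieszSum_le hne ?_ (by positivity) ?_
  · intro χ hχ x hx
    obtain ⟨c, d, -, -, rfl⟩ := hA χ hχ
    simp [hφ x hx, hψ x hx]
  · intro x v h
    obtain ⟨w₁, w₂, a1, a2, a3, a4, rfl⟩ := h.exists_eq_of_combination hC hA
    have hx := h.mem_cone hC
    have b1 := h1 w₁ ⟨_, a2, _, hx, by abel⟩
    have b2 := h2 w₂ ⟨_, a4, _, hx, by abel⟩
    have c1 := mul_le_mul_of_nonneg_left (hE.norm_le_three_mul a1 a2) hK
    have c2 := mul_le_mul_of_nonneg_left (hE.norm_le_three_mul a3 a4) hK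
    linarith

theorem _root_.re_apply_le_norm (φ : StrongDual ℂ E) (x : E) : (φ x).re ≤ ‖φ‖ * ‖x‖ :=
  (Complex.re_le_norm _).trans (φ.le_opNorm x)

theorem exists_isConeSup_pair_dual (hE : IsComplexBanachLattice C (normSeminorm ℂ E))
    {φ ψ : StrongDual ℂ E} (hφ : ∀ x ∈ C, (φ x).im = 0) (hψ : ∀ x ∈ C, (ψ x).im = 0) :
    ∃ m, IsConeSup (dualCone C) {φ, ψ} m := by
  obtain ⟨m, hm, -⟩ := hE.exists_isConeSup_of_combination hφ hψ (A := {φ, ψ}) ⟨φ, by simp⟩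
    (by
      rintro χ (rfl | rfl)
      · exact ⟨1, 0, by simp, by simp, by push_cast; module⟩
      · exact ⟨0, 1, by simp, by simp, by push_cast; module⟩)
    (K := max ‖φ‖ ‖ψ‖) (by positivity)
    (fun w _ => (re_apply_le_norm φ w).trans
      (mul_le_mul_of_nonneg_right (le_max_left _ _) (norm_nonneg _)))
    (fun w _ => (re_apply_le_norm ψ w).trans
      (mul_le_mul_of_nonneg_right (le_max_right _ _) (norm_nonneg _)))
  exact ⟨m, hm⟩

theorem mem_coneReal_dualCone_iff (hE : IsComplexBanachLattice C (normSeminorm ℂ E))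
    {φ : StrongDual ℂ E} : φ ∈ coneReal (dualCone C) ↔ ∀ x ∈ C, (φ x).im = 0 := by
  constructor
  · rintro ⟨a, ha, b, hb, rfl⟩ x hx
    simp [(ha x hx).2, (hb x hx).2]
  · intro hφ
    -- Here `m = φ⁺`, and `φ = φ⁺ - (φ⁺ - φ)`.
    obtain ⟨m, hm, -⟩ := hE.exists_isConeSup_pair_dual hφ (ψ := 0) (by simp)
    exact ⟨m, by simpa using hm 0 (by simp), m - φ, hm φ (by simp), by abel⟩

/-- Every functional is `φ₁ + i φ₂` with real `φ₁`, `φ₂`. -/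
theorem exists_re_im_dual (hE : IsComplexBanachLattice C (normSeminorm ℂ E))
    (φ : StrongDual ℂ E) : ∃ φ₁ ∈ coneReal (dualCone C), ∃ φ₂ ∈ coneReal (dualCone C),
      φ = φ₁ + Complex.I • φ₂ := by
  -- `Re φ` is not complex linear on `E`; only its values on the cone are kept and extended.
  obtain ⟨φ₁, h₁⟩ := hE.exists_strongDual_extension (fun x => (φ x).re) (by simp) (by simp)
    (norm_nonneg φ) fun x _ => (Complex.abs_re_le_norm _).trans (φ.le_opNorm x)
  obtain ⟨φ₂, h₂⟩ := hE.exists_strongDual_extension (fun x => (φ x).im) (by simp) (by simp)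
    (norm_nonneg φ) fun x _ => (Complex.abs_im_le_norm _).trans (φ.le_opNorm x)
  refine ⟨φ₁, hE.mem_coneReal_dualCone_iff.2 fun x hx => by simp [h₁ x hx], φ₂,
    hE.mem_coneReal_dualCone_iff.2 fun x hx => by simp [h₂ x hx], hE.strongDual_ext fun x hx => ?_⟩
  apply Complex.ext <;> simp [h₁ x hx, h₂ x hx]

/-- On real vectors `φ₁` and `φ₂` are the real and imaginary parts of `φ₁ + iφ₂`, so the norm of the
latter controls both. -/
theorem exists_isConeSup_rotations_dual (hE : IsComplexBanachLattice C (normSeminorm ℂ E))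
    {φ₁ φ₂ : StrongDual ℂ E} (h₁ : φ₁ ∈ coneReal (dualCone C)) (h₂ : φ₂ ∈ coneReal (dualCone C)) :
    ∃ m, IsConeSup (dualCone C)
      (Set.range fun θ : ℝ => ((Real.cos θ : ℝ) : ℂ) • φ₁ + ((Real.sin θ : ℝ) : ℂ) • φ₂) m ∧
      ∀ x ∈ C, (m x).re ≤ 6 * ‖φ₁ + Complex.I • φ₂‖ * ‖x‖ := by
  rw [hE.mem_coneReal_dualCone_iff] at h₁ h₂
  have him : ∀ {φ : StrongDual ℂ E}, (∀ x ∈ C, (φ x).im = 0) → ∀ w ∈ coneReal C,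
      (φ w).im = 0 := by
    rintro φ hφ _ ⟨a, ha, b, hb, rfl⟩
    simp [hφ a ha, hφ b hb]
  have hn := fun w => (φ₁ + Complex.I • φ₂).le_opNorm w
  refine hE.exists_isConeSup_of_combination h₁ h₂ (Set.range_nonempty _) ?_ (norm_nonneg _) ?_ ?_
  · rintro _ ⟨θ, rfl⟩
    exact ⟨_, _, Real.abs_cos_le_one θ, Real.abs_sin_le_one θ, rfl⟩
  · intro w hw
    have := (Complex.re_le_norm _).trans (hn w)
    simpa [him h₂ w hw] using this
  · intro w hw
    have := (Complex.abs_im_le_norm _).trans (hn w)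
    have := (le_abs_self _).trans this
    simpa [him h₁ w hw] using this

end IsComplexBanachLattice

/-! ### A monotone gauge on the dual. -/

/-- The supremum of `Re μ` over the positive part of the unit ball. -/
noncomputable def coneNorm (C : Set E) (μ : StrongDual ℂ E) : ℝ :=
  sSup ((fun x => (μ x).re) '' {x | x ∈ C ∧ ‖x‖ ≤ 1})

theorem re_apply_le_coneNorm (μ : StrongDual ℂ E) {x : E} (hx : x ∈ C) (h : ‖x‖ ≤ 1) :
    (μ x).re ≤ coneNorm C μ := by
  refine le_csSup ⟨‖μ‖, ?_⟩ ⟨x, ⟨hx, h⟩, rfl⟩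
  rintro _ ⟨y, hy, rfl⟩
  exact (re_apply_le_norm μ y).trans (mul_le_of_le_one_right (norm_nonneg _) hy.2)

theorem coneNorm_le (h0 : (0 : E) ∈ C) {μ : StrongDual ℂ E} {K : ℝ}
    (h : ∀ x ∈ C, ‖x‖ ≤ 1 → (μ x).re ≤ K) : coneNorm C μ ≤ K := by
  refine csSup_le ⟨_, 0, ⟨h0, by simp⟩, rfl⟩ ?_
  rintro _ ⟨y, hy, rfl⟩
  exact h y hy.1 hy.2

theorem coneNorm_nonneg (h0 : (0 : E) ∈ C) (μ : StrongDual ℂ E) : 0 ≤ coneNorm C μ := by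
  simpa using re_apply_le_coneNorm μ h0 (by simp)

theorem coneNorm_add_le (h0 : (0 : E) ∈ C) (μ ν : StrongDual ℂ E) :
    coneNorm C (μ + ν) ≤ coneNorm C μ + coneNorm C ν :=
  coneNorm_le h0 fun _ hx h => by
    simpa using add_le_add (re_apply_le_coneNorm μ hx h) (re_apply_le_coneNorm ν hx h)

theorem coneNorm_smul_le (h0 : (0 : E) ∈ C) {r : ℝ} (hr : 0 ≤ r) (μ : StrongDual ℂ E) :
    coneNorm C ((r : ℂ) • μ) ≤ r * coneNorm C μ :=
  coneNorm_le h0 fun _ hx h => by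
    simpa using mul_le_mul_of_nonneg_left (re_apply_le_coneNorm μ hx h) hr

/-- Monotonicity is immediate for this gauge, which is why it replaces the operator norm in the
renorming. -/
theorem coneNorm_mono (h0 : (0 : E) ∈ C) {μ ν : StrongDual ℂ E} (hle : ν - μ ∈ dualCone C) :
    coneNorm C μ ≤ coneNorm C ν :=
  coneNorm_le h0 fun x hx h => by
    have := (hle x hx).1
    simp only [sub_apply, Complex.sub_re] at this
    linarith [re_apply_le_coneNorm ν hx h]

namespace IsComplexBanachLattice

theorem re_apply_le_coneNorm_mul (hE : IsComplexBanachLattice C (normSeminorm ℂ E))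
    (μ : StrongDual ℂ E) {x : E} (hx : x ∈ C) : (μ x).re ≤ coneNorm C μ * ‖x‖ := by
  rcases eq_or_ne x 0 with rfl | h
  · simp
  · have hpos := norm_pos_iff.2 h
    have := re_apply_le_coneNorm μ (hE.smul_mem ‖x‖⁻¹ (by positivity) x hx)
      (by rw [norm_smul, Complex.norm_real, norm_inv, norm_norm, inv_mul_cancel₀ hpos.ne'])
    rw [map_smul, smul_eq_mul, Complex.re_ofReal_mul, inv_mul_le_iff₀ hpos] at this
    linarith

/-- On the cone `|φ|` and `|ψ|` are at most `m`, so their combination is bounded there by twice the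
gauge; passing from the cone to `E` costs the factor 6. -/
theorem norm_le_coneNorm (hE : IsComplexBanachLattice C (normSeminorm ℂ E))
    {φ ψ m : StrongDual ℂ E} (h1 : m - φ ∈ dualCone C) (h2 : m + φ ∈ dualCone C)
    (h3 : m - ψ ∈ dualCone C) (h4 : m + ψ ∈ dualCone C) :
    ‖φ + Complex.I • ψ‖ ≤ 12 * coneNorm C m := by
  have key : ∀ χ : StrongDual ℂ E, m - χ ∈ dualCone C → m + χ ∈ dualCone C → ∀ x ∈ C,
      ‖χ x‖ ≤ coneNorm C m * ‖x‖ := by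
    intro χ h1 h2 x hx
    have a1 := h1 x hx
    have a2 := h2 x hx
    simp only [sub_apply, add_apply, Complex.sub_re,
      Complex.add_re, Complex.sub_im, Complex.add_im] at a1 a2
    have e : χ x = ((χ x).re : ℂ) := Complex.ext rfl (by simp; linarith)
    have := hE.re_apply_le_coneNorm_mul m hx
    rw [e, Complex.norm_real, Real.norm_eq_abs, abs_le]
    constructor <;> linarith
  have hn := coneNorm_nonneg hE.zero_mem m
  have := hE.opNorm_le_of_cone (φ + Complex.I • ψ) (K := 2 * coneNorm C m) (by positivity)
    fun x hx => by
      have h := norm_add_le (φ x) (Complex.I * ψ x)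
      rw [norm_mul, Complex.norm_I, one_mul] at h
      have := key φ h1 h2 x hx
      have := key ψ h3 h4 x hx
      simp only [add_apply, smul_apply, smul_eq_mul]
      linarith
  linarith

end IsComplexBanachLattice

end Dual

/-! ### Limits along idempotent ultrafilters and the projection. -/

section UltrafilterLimit

/-- An idempotent of `βS` lying in all the sets `s + βS`. -/
theorem exists_idempotent_tail_ultrafilter (S : Type*) [AddCommMonoid S] :
    ∃ p : Ultrafilter S,
      (∀ A : S → Prop, (∀ᶠ s in (p : Filter S), A s) →
        ∀ᶠ s in (p : Filter S), ∀ᶠ t in (p : Filter S), A (s + t)) ∧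
      ∀ s : S, ∃ r : Ultrafilter S, r.map (s + ·) = p := by
  let : AddSemigroup (Ultrafilter S) := Ultrafilter.addSemigroup
  let H : Set (Ultrafilter S) := {p | ∀ s : S, Set.range (s + ·) ∈ p}
  have hclosed : IsClosed H := by
    have : H = ⋂ s : S, {p : Ultrafilter S | Set.range (s + ·) ∈ p} := by
      ext p
      simp [H]
    rw [this]
    exact isClosed_iInter fun s => ultrafilter_isClosed_basic _
  have hne : H.Nonempty := by
    have hbot : (⨅ s : S, 𝓟 (Set.range (s + ·))).NeBot := by
      refine iInf_neBot_of_directed' ?_ fun s => principal_neBot_iff.2 (Set.range_nonempty _)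
      intro s t
      refine ⟨s + t, principal_mono.2 ?_, principal_mono.2 ?_⟩
      · rintro _ ⟨u, rfl⟩
        exact ⟨t + u, (add_assoc s t u).symm⟩
      · rintro _ ⟨u, rfl⟩
        exact ⟨s + u, by simp only; abel⟩
    refine ⟨@Ultrafilter.of _ _ hbot, fun s => ?_⟩
    exact (Ultrafilter.of_le _).trans (iInf_le _ s) (mem_principal_self _)
  -- Ellis' lemma for the compact subsemigroup `H` of `βS`.
  obtain ⟨p, hpH, hp⟩ := exists_idempotent_in_compact_add_subsemigroup
    Ultrafilter.continuous_add_left H hne hclosed.isCompact (by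
      intro p hp q _ s
      have : ∀ᶠ m in (↑(p + q) : Filter S), m ∈ Set.range (s + ·) := by
        rw [Ultrafilter.eventually_add]
        filter_upwards [hp s]
        rintro _ ⟨a, rfl⟩
        exact Eventually.of_forall fun b => ⟨a + b, (add_assoc s a b).symm⟩
      exact this)
  refine ⟨p, fun A hA => ?_, fun s => ?_⟩
  · rw [← Ultrafilter.eventually_add, hp]
    exact hA
  -- Since `s + S` belongs to `p`, the pullback of `p` is a proper filter, and any finer ultrafilter
  -- is mapped onto `p`.
  · have hne : (comap (s + ·) (p : Filter S)).NeBot :=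
      comap_neBot_iff_compl_range.2 fun h => by
        have := p.compl_notMem_iff.2 (hpH s)
        exact this h
    refine ⟨@Ultrafilter.of _ _ hne, Ultrafilter.coe_le_coe.1 ?_⟩
    exact (map_mono (Ultrafilter.of_le _)).trans map_comap_le

variable {S : Type*} [AddCommMonoid S] {E : Type*} [NormedAddCommGroup E] [NormedSpace ℂ E]

/-- Limits of a bounded dual representation along an ultrafilter, in the weak* operator topology. -/
theorem exists_dualRep_limit (T : SemigroupRep S (E →L[ℂ] E)) {M : ℝ} (hM : ∀ s, ‖T s‖ ≤ M)
    (p : Ultrafilter S) : ∃ Q : StrongDual ℂ E →L[ℂ] StrongDual ℂ E, ∀ φ x,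
      Tendsto (fun s => φ (T s x)) p (𝓝 (Q φ x)) := by
  have hb : ∀ (φ : StrongDual ℂ E) x s, ‖φ (T s x)‖ ≤ M * ‖φ‖ * ‖x‖ := by
    intro φ x s
    calc ‖φ (T s x)‖ ≤ ‖φ‖ * (‖T s‖ * ‖x‖) := φ.le_opNorm_of_le ((T s).le_opNorm x)
      _ ≤ ‖φ‖ * (M * ‖x‖) := by gcongr; exact hM s
      _ = _ := by ring
  have hlim : ∀ (φ : StrongDual ℂ E) x, ∃ l, Tendsto (fun s => φ (T s x)) p (𝓝 l) := by
    intro φ x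
    obtain ⟨l, -, hl⟩ := (isCompact_closedBall (0 : ℂ) (M * ‖φ‖ * ‖x‖)).ultrafilter_le_nhds
      (p.map fun s => φ (T s x)) (by
        rw [le_principal_iff, Ultrafilter.coe_map, mem_map]
        exact univ_mem' fun s => mem_closedBall_zero_iff.2 (hb φ x s))
    exact ⟨l, hl⟩
  choose L hL using hlim
  let B : StrongDual ℂ E →ₗ[ℂ] E →ₗ[ℂ] ℂ := LinearMap.mk₂ ℂ L
    (fun φ ψ x => tendsto_nhds_unique (hL _ x) (by simpa using (hL φ x).add (hL ψ x)))
    (fun c φ x => tendsto_nhds_unique (hL _ x) (by simpa using (hL φ x).const_mul c))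
    (fun φ x y => tendsto_nhds_unique (hL φ _) (by simpa using (hL φ x).add (hL φ y)))
    (fun c φ x => tendsto_nhds_unique (hL φ _) (by simpa using (hL φ x).const_mul c))
  refine ⟨B.mkContinuous₂ M fun φ x => ?_, hL⟩
  exact le_of_tendsto (hL φ x).norm (Eventually.of_forall fun s => hb φ x s)

@[simp]
theorem dualRep_apply_apply (T : SemigroupRep S (E →L[ℂ] E)) (s : S) (φ : StrongDual ℂ E) (x : E) :
    dualRep T s φ x = φ (T s x) := rfl

/-- A Jacobs–de Leeuw–Glicksberg type projection for the dual of a bounded positive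
representation. -/
theorem exists_dualRep_projection {C : Set E} (T : SemigroupRep S (E →L[ℂ] E))
    (hpos : ∀ s, ∀ x ∈ C, T s x ∈ C) (hbdd : ∃ M : ℝ, ∀ s, ‖T s‖ ≤ M) :
    ∃ P : StrongDual ℂ E →L[ℂ] StrongDual ℂ E,
      (∀ φ, P (P φ) = P φ) ∧ (∀ φ ∈ dualCone C, P φ ∈ dualCone C) ∧
      (∀ s φ, P (dualRep T s φ) = dualRep T s (P φ)) ∧
      (∀ χ : AddChar S Circle, ∀ φ ∈ eigenspaceRep (dualRep T) χ, P φ = φ) ∧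
      ∀ s, ∃ Q : StrongDual ℂ E →L[ℂ] StrongDual ℂ E, (∀ φ ∈ dualCone C, Q φ ∈ dualCone C) ∧
        (∀ φ, Q (dualRep T s φ) = P φ) ∧ ∀ φ, dualRep T s (Q φ) = P φ := by
  obtain ⟨M, hM⟩ := hbdd
  obtain ⟨p, hp, hr⟩ := exists_idempotent_tail_ultrafilter S
  have hmap : ∀ (s t : S) (x : E), T (s + t) x = T s (T t x) := fun s t x => by
    rw [AddChar.map_add_eq_mul]
    rfl
  have hcone : ∀ {q : Ultrafilter S} {Q : StrongDual ℂ E →L[ℂ] StrongDual ℂ E},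
      (∀ φ x, Tendsto (fun s => φ (T s x)) q (𝓝 (Q φ x))) →
      ∀ φ ∈ dualCone C, Q φ ∈ dualCone C := by
    intro q Q hQ φ hφ x hx
    constructor
    · exact ge_of_tendsto ((Complex.continuous_re.tendsto _).comp (hQ φ x))
        (Eventually.of_forall fun s => (hφ _ (hpos s x hx)).1)
    · refine tendsto_nhds_unique ((Complex.continuous_im.tendsto _).comp (hQ φ x)) ?_
      exact tendsto_const_nhds.congr fun s => (hφ _ (hpos s x hx)).2.symm
  obtain ⟨P, hP⟩ := exists_dualRep_limit T hM p
  have hidem : ∀ φ, P (P φ) = P φ := by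
    intro φ
    ext x
    -- `P(Pφ)x` is the iterated limit of `φ(T_{s+t} x)`. Idempotence of `p` puts these values
    -- eventually in a closed ball around `Pφ x`, and closed balls survive both limits.
    refine eq_of_dist_eq_zero (le_antisymm (le_of_forall_pos_le_add fun ε hε => ?_) dist_nonneg)
    rw [zero_add]
    have h1 := hp _ ((hP φ x).eventually (Metric.closedBall_mem_nhds _ hε))
    refine Metric.isClosed_closedBall.mem_of_tendsto (hP (P φ) x) ?_
    filter_upwards [h1] with s hs
    refine Metric.isClosed_closedBall.mem_of_tendsto (hP φ (T s x)) ?_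
    filter_upwards [hs] with t ht
    rwa [← hmap, add_comm]
  refine ⟨P, hidem, hcone hP, fun s φ => ?_, fun χ φ hφ => ?_, fun s => ?_⟩
  · ext x
    refine tendsto_nhds_unique (hP _ x) ((hP φ (T s x)).congr fun t => ?_)
    rw [dualRep_apply_apply, ← hmap, ← hmap, add_comm]
  -- Compactness of the circle gives `Pφ = cφ`; then `c²φ = cφ`, and `c ≠ 0` cancels.
  · obtain ⟨c, -, hc⟩ := (isCompact_univ (X := Circle)).ultrafilter_le_nhds (p.map χ) (by simp)
    have hlim : Tendsto (fun s => (χ s : ℂ)) p (𝓝 (c : ℂ)) :=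
      ((continuous_subtype_val (p := (· ∈ Submonoid.unitSphere ℂ))).tendsto c).comp (show Tendsto χ p (𝓝 c) from hc)
    have hPφ : P φ = (c : ℂ) • φ := by
      ext x
      refine tendsto_nhds_unique (hP φ x) ((hlim.mul_const (φ x)).congr fun s => ?_)
      have := DFunLike.congr_fun (hφ s) x
      simpa using this.symm
    have h2 := hidem φ
    rw [hPφ, map_smul, hPφ] at h2
    rw [hPφ]
    exact smul_right_injective _ c.coe_ne_zero h2
  -- `Q` is the limit along `r` with `s + r = p`; commutativity lets `T'_s` be absorbed on either
  -- side.
  · obtain ⟨r, hr⟩ := hr s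
    obtain ⟨Q, hQ⟩ := exists_dualRep_limit T hM r
    have key : ∀ φ x, Tendsto (fun t => φ (T (s + t) x)) r (𝓝 (P φ x)) := by
      intro φ x
      have := hP φ x
      rw [← hr] at this
      exact tendsto_map'_iff.1 this
    refine ⟨Q, hcone hQ, fun φ => ?_, fun φ => ?_⟩
    · ext x
      exact tendsto_nhds_unique (hQ _ x) ((key φ x).congr fun t => by
        rw [hmap, dualRep_apply_apply])
    · ext x
      exact tendsto_nhds_unique (hQ φ (T s x)) ((key φ x).congr fun t => by
        rw [add_comm, hmap])

end UltrafilterLimit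

/-! ### The range of a positive projection as a Banach lattice. -/

section FixedSpace

variable {E : Type*} [NormedAddCommGroup E] [NormedSpace ℂ E] {C : Set E}

theorem zero_mem_dualCone : (0 : StrongDual ℂ E) ∈ dualCone C := by
  simp [dualCone]

theorem add_mem_dualCone {φ ψ : StrongDual ℂ E} (hφ : φ ∈ dualCone C) (hψ : ψ ∈ dualCone C) :
    φ + ψ ∈ dualCone C := by
  intro x hx
  have h1 := hφ x hx
  have h2 := hψ x hx
  simp only [add_apply, Complex.add_re, Complex.add_im]
  exact ⟨add_nonneg h1.1 h2.1, by rw [h1.2, h2.2, add_zero]⟩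

theorem smul_mem_dualCone {φ : StrongDual ℂ E} {r : ℝ} (hr : 0 ≤ r) (hφ : φ ∈ dualCone C) :
    (r : ℂ) • φ ∈ dualCone C := by
  intro x hx
  have h1 := hφ x hx
  simpa [h1.2] using mul_nonneg hr h1.1

/-- The fixed space of an operator on the dual. -/
noncomputable def fixedSpace (P : StrongDual ℂ E →L[ℂ] StrongDual ℂ E) : Submodule ℂ (StrongDual ℂ E) :=
  LinearMap.eqLocus (P : StrongDual ℂ E →ₗ[ℂ] StrongDual ℂ E) LinearMap.id

theorem mem_fixedSpace {P : StrongDual ℂ E →L[ℂ] StrongDual ℂ E} {φ : StrongDual ℂ E} :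
    φ ∈ fixedSpace P ↔ P φ = φ := Iff.rfl

theorem isClosed_fixedSpace (P : StrongDual ℂ E →L[ℂ] StrongDual ℂ E) :
    IsClosed (fixedSpace P : Set (StrongDual ℂ E)) :=
  isClosed_eq P.continuous continuous_id

theorem coe_mem_coneReal {V : Type*} [AddCommGroup V] [Module ℂ V] {D : Set V}
    {F : Submodule ℂ V} {x : F} (hx : x ∈ coneReal (inheritedCone D F)) :
    (x : V) ∈ coneReal D := by
  obtain ⟨a, ha, b, hb, rfl⟩ := hx
  exact ⟨a, ha, b, hb, rfl⟩

section Projection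

variable {P : StrongDual ℂ E →L[ℂ] StrongDual ℂ E} (hidem : ∀ φ, P (P φ) = P φ)
  (hP : ∀ φ ∈ dualCone C, P φ ∈ dualCone C)

/-- A projection on the dual, as a linear map onto its fixed space. -/
noncomputable def toFixedSpace (hidem : ∀ φ, P (P φ) = P φ) : StrongDual ℂ E →ₗ[ℂ] fixedSpace P :=
  (P : StrongDual ℂ E →ₗ[ℂ] StrongDual ℂ E).codRestrict (fixedSpace P) hidem

include hP in
theorem toFixedSpace_mem_coneReal {φ : StrongDual ℂ E} (hφ : φ ∈ coneReal (dualCone C)) :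
    toFixedSpace hidem φ ∈ coneReal (inheritedCone (dualCone C) (fixedSpace P)) := by
  obtain ⟨a, ha, b, hb, rfl⟩ := hφ
  exact ⟨toFixedSpace hidem a, hP a ha, toFixedSpace hidem b, hP b hb,
    Subtype.ext (map_sub P a b)⟩

theorem toFixedSpace_coe (φ : fixedSpace P) : toFixedSpace hidem φ = φ :=
  Subtype.ext φ.2

include hP in
/-- Suprema in the range of a positive projection are obtained by projecting suprema. -/
theorem isConeSup_toFixedSpace {A : Set (fixedSpace P)} {m : StrongDual ℂ E}
    (hm : IsConeSup (dualCone C) ((↑) '' A) m) :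
    IsConeSup (inheritedCone (dualCone C) (fixedSpace P)) A (toFixedSpace hidem m) := by
  constructor
  · intro a ha
    have := hP _ (hm.1 a ⟨a, ha, rfl⟩)
    rw [map_sub, mem_fixedSpace.1 a.2] at this
    exact this
  · intro u hu
    have := hP _ (hm.2 u (by rintro _ ⟨a, ha, rfl⟩; exact hu a ha))
    rw [map_sub, mem_fixedSpace.1 u.2] at this
    exact this

include hidem hP in
theorem exists_re_im_fixedSpace (hE : IsComplexBanachLattice C (normSeminorm ℂ E))
    (z : fixedSpace P) : ∃ x ∈ coneReal (inheritedCone (dualCone C) (fixedSpace P)),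
      ∃ y ∈ coneReal (inheritedCone (dualCone C) (fixedSpace P)), z = x + Complex.I • y := by
  obtain ⟨x, hx, y, hy, e⟩ := hE.exists_re_im_dual (z : StrongDual ℂ E)
  refine ⟨_, toFixedSpace_mem_coneReal hidem hP hx, _, toFixedSpace_mem_coneReal hidem hP hy, ?_⟩
  rw [← map_smul, ← map_add, ← e, toFixedSpace_coe]

include hidem hP in
-- The modulus in `F` is `P` of the modulus in the dual, so its gauge is at most `‖P‖` times the
-- norm of the latter; `72 = 12 · 6`.
theorem exists_isModulus_fixedSpace (hE : IsComplexBanachLattice C (normSeminorm ℂ E))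
    (z : fixedSpace P) : ∃ m, IsModulus (inheritedCone (dualCone C) (fixedSpace P)) z m ∧
      coneNorm C m ≤ 72 * ‖P‖ * ‖z‖ := by
  obtain ⟨x, hx, y, hy, rfl⟩ := exists_re_im_fixedSpace hidem hP hE z
  obtain ⟨m, hm, hmb⟩ := hE.exists_isConeSup_rotations_dual (coe_mem_coneReal hx)
    (coe_mem_coneReal hy)
  refine ⟨toFixedSpace hidem m, ⟨x, hx, y, hy, rfl, isConeSup_toFixedSpace hidem hP ?_⟩, ?_⟩
  · rw [← Set.range_comp]
    exact hm
  · have hmC : m ∈ dualCone C := by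
      have h1 := hm.1 _ ⟨0, rfl⟩
      have h2 := hm.1 _ ⟨Real.pi, rfl⟩
      have h3 := smul_mem_dualCone (r := 1 / 2) (by norm_num) (add_mem_dualCone h1 h2)
      convert h3 using 1
      simp only [Real.cos_zero, Real.sin_zero, Real.cos_pi, Real.sin_pi]
      push_cast
      module
    have h1 : ‖m‖ ≤ 12 * coneNorm C m := by
      have := hE.norm_le_coneNorm (φ := m) (ψ := 0) (m := m) (by simpa using zero_mem_dualCone)
        (add_mem_dualCone hmC hmC) (by simpa) (by simpa)
      rwa [show m + Complex.I • (0 : StrongDual ℂ E) = m by module] at this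
    have h2 : coneNorm C m ≤ 6 * ‖x + Complex.I • y‖ :=
      coneNorm_le hE.zero_mem fun v hv h => (hmb v hv).trans
        (mul_le_of_le_one_right (by positivity) h)
    have h3 : coneNorm C (P m) ≤ ‖P m‖ :=
      coneNorm_le hE.zero_mem fun v _ h => (re_apply_le_norm _ v).trans
        (mul_le_of_le_one_right (norm_nonneg _) h)
    calc coneNorm C (P m) ≤ ‖P‖ * ‖m‖ := h3.trans (P.le_opNorm m)
      _ ≤ ‖P‖ * (12 * (6 * ‖x + Complex.I • y‖)) := by gcongr; linarith
      _ = _ := by ring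

include hidem hP in
/-- The range of a positive projection on the dual is a complex vector lattice. -/
theorem isComplexVectorLattice_fixedSpace (hE : IsComplexBanachLattice C (normSeminorm ℂ E)) :
    IsComplexVectorLattice (inheritedCone (dualCone C) (fixedSpace P)) where
  zero_mem := zero_mem_dualCone
  add_mem _ hx _ hy := add_mem_dualCone hx hy
  smul_mem _ hr _ hx := smul_mem_dualCone hr hx
  eq_zero_of_neg_mem x hx hx' := Subtype.ext <| hE.strongDual_ext fun v hv => by
    have h1 := hx v hv
    have h2 := (hx' v hv).1
    simp only [Submodule.coe_neg, neg_apply, Complex.neg_re] at h2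
    exact Complex.ext (le_antisymm (by simpa using h2) h1.1) h1.2
  exists_decomp := exists_re_im_fixedSpace hidem hP hE
  eq_zero_of_I_smul x hx hx' := Subtype.ext <| hE.strongDual_ext fun v hv => by
    have h1 := hE.mem_coneReal_dualCone_iff.1 (coe_mem_coneReal hx) v hv
    have h2 := hE.mem_coneReal_dualCone_iff.1 (coe_mem_coneReal hx') v hv
    exact Complex.ext (by simpa using h2) (by simpa using h1)
  exists_sup x hx y hy := by
    obtain ⟨m, hm⟩ := hE.exists_isConeSup_pair_dual
      (hE.mem_coneReal_dualCone_iff.1 (coe_mem_coneReal hx))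
      (hE.mem_coneReal_dualCone_iff.1 (coe_mem_coneReal hy))
    exact ⟨_, isConeSup_toFixedSpace hidem hP (by rwa [Set.image_pair])⟩
  exists_modulus z := (exists_isModulus_fixedSpace hidem hP hE z).imp fun _ h => h.1

include hidem hP in
/-- The range of a positive projection on the dual is a Banach lattice for an equivalent norm. -/
theorem exists_isComplexBanachLattice_fixedSpace
    (hE : IsComplexBanachLattice C (normSeminorm ℂ E)) :
    ∃ N : Seminorm ℂ (fixedSpace P),
      (∃ a b : ℝ, 0 < a ∧ 0 < b ∧ ∀ φ, a * ‖φ‖ ≤ N φ ∧ N φ ≤ b * ‖φ‖) ∧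
      IsComplexBanachLattice (inheritedCone (dualCone C) (fixedSpace P)) N := by
  have hF := isComplexVectorLattice_fixedSpace hidem hP hE
  have h0 := hE.zero_mem
  have hcoe : ∀ φ : fixedSpace P, ‖φ‖ = ‖(φ : StrongDual ℂ E)‖ := fun _ => rfl
  choose μ hμ hμb using exists_isModulus_fixedSpace hidem hP hE
  have hself : ∀ x ∈ inheritedCone (dualCone C) (fixedSpace P), μ x = x := fun x hx =>
    hF.isModulus_unique (hμ x) (hF.isModulus_self hx)
  -- The triangle inequality and homogeneity follow from those of the modulus of `F`, as the gauge
  -- is monotone.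
  let N : Seminorm ℂ (fixedSpace P) := Seminorm.ofSMulLE (fun φ => coneNorm C (μ φ))
    (by
      rw [hself 0 hF.zero_mem]
      exact le_antisymm (coneNorm_le h0 (by simp)) (coneNorm_nonneg h0 _))
    (fun φ ψ => (coneNorm_mono h0 (hF.isModulus_add_le (hμ φ) (hμ ψ) (hμ (φ + ψ)))).trans
      (coneNorm_add_le h0 _ _))
    (fun c φ => (coneNorm_mono h0 (hF.isModulus_smul_le c (hμ φ) (hμ (c • φ)))).trans
      (coneNorm_smul_le h0 (norm_nonneg c) _))
  have hN : ∀ φ, N φ = coneNorm C (μ φ) := fun _ => rfl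
  have hlow : ∀ φ, 1 / 12 * ‖φ‖ ≤ N φ := by
    intro φ
    obtain ⟨x, y, e, -, h1, h2, h3, h4⟩ := hF.exists_re_im_le_of_isModulus (hμ φ)
    have := hE.norm_le_coneNorm (m := μ φ) h1 h2 h3 h4
    have e' : ‖φ‖ = ‖(x : StrongDual ℂ E) + Complex.I • (y : StrongDual ℂ E)‖ := by
      conv_lhs => rw [e]
      rfl
    rw [hN]
    linarith
  -- The summand 1 keeps the constant positive when `P = 0`.
  have hup : ∀ φ, N φ ≤ (72 * ‖P‖ + 1) * ‖φ‖ := fun φ => by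
    have := hμb φ
    have := norm_nonneg φ
    rw [hN]
    linarith
  refine ⟨N, ⟨1 / 12, 72 * ‖P‖ + 1, by norm_num, by positivity, fun φ => ⟨hlow φ, hup φ⟩⟩, ?_⟩
  refine ⟨hF.zero_mem, hF.add_mem, hF.smul_mem, hF.eq_zero_of_neg_mem, hF.exists_decomp,
    hF.eq_zero_of_I_smul, hF.exists_sup, hF.exists_modulus, ?_, ?_, ?_, ?_⟩
  · intro z m hm
    rw [hN, hN, hself m (hF.isModulus_mem hm), hF.isModulus_unique (hμ z) hm]
  · intro x hx y hxy
    have hy : y ∈ inheritedCone (dualCone C) (fixedSpace P) := by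
      simpa using hF.add_mem _ hx _ hxy
    rw [hN, hN, hself x hx, hself y hy]
    exact coneNorm_mono h0 hxy
  · intro x hx
    have := hlow x
    rw [hx] at this
    exact Subtype.ext (norm_le_zero_iff.1 (by linarith [hcoe x]))
  · intro u hu
    -- Completeness transfers from the dual because `F` is closed and the norms are equivalent.
    have hcauchy : CauchySeq fun n => (u n : StrongDual ℂ E) := by
      refine Metric.cauchySeq_iff.2 fun ε hε => ?_
      obtain ⟨n₀, hn⟩ := hu (1 / 12 * ε) (by positivity)
      refine ⟨n₀, fun m hm n hn' => ?_⟩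
      rw [dist_eq_norm]
      have h1 := hlow (u m - u n)
      have h2 := hn m hm n hn'
      rw [hcoe, Submodule.coe_sub] at h1
      linarith
    obtain ⟨v, hv⟩ := cauchySeq_tendsto_of_complete hcauchy
    have hvF : v ∈ fixedSpace P :=
      (isClosed_fixedSpace P).mem_of_tendsto hv (Eventually.of_forall fun n => (u n).2)
    refine ⟨⟨v, hvF⟩, squeeze_zero (fun n => apply_nonneg N _) (fun n => hup _) ?_⟩
    simpa [hcoe] using (tendsto_iff_norm_sub_tendsto_zero.1 hv).const_mul (72 * ‖P‖ + 1)

end Projection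

end FixedSpace

/-! ### The invariant Banach lattice of the dual representation. -/

theorem lemma3p15 {S : Type*} [AddCommMonoid S]
    {E : Type*} [NormedAddCommGroup E] [NormedSpace ℂ E]
    (C : Set E) (hE : IsComplexBanachLattice C (normSeminorm ℂ E))
    (T : SemigroupRep S (E →L[ℂ] E))
    (hpos : ∀ s, ∀ x ∈ C, T s x ∈ C)
    (hbdd : ∃ M : ℝ, ∀ s, ‖T s‖ ≤ M) :
    ∃ (F : Submodule ℂ (StrongDual ℂ E)) (hF : ∀ s, ∀ φ ∈ F, dualRep T s φ ∈ F)
      (N : Seminorm ℂ F),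
      IsClosed (F : Set (StrongDual ℂ E)) ∧
      (∃ a b : ℝ, 0 < a ∧ 0 < b ∧ ∀ φ : F, a * ‖φ‖ ≤ N φ ∧ N φ ≤ b * ‖φ‖) ∧
      IsComplexBanachLattice (inheritedCone (dualCone C) F) N ∧
      (∀ χ : AddChar S Circle, eigenspaceRep (dualRep T) χ ⊆ (F : Set (StrongDual ℂ E))) ∧
      (∃ M : ℝ, ∀ s, ∀ φ : F, N (restrictRep (dualRep T) F hF s φ) ≤ M * N φ) ∧
      (∀ s, IsLatticeIsomorphism (inheritedCone (dualCone C) F)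
        (restrictRep (dualRep T) F hF s)) := by
  obtain ⟨P, hidem, hP, hcomm, heig, hinv⟩ := exists_dualRep_projection T hpos hbdd
  obtain ⟨N, ⟨a, b, ha, hb, hab⟩, hN⟩ := exists_isComplexBanachLattice_fixedSpace hidem hP hE
  have hF : ∀ s, ∀ φ ∈ fixedSpace P, dualRep T s φ ∈ fixedSpace P := fun s φ hφ => by
    rw [mem_fixedSpace, hcomm, mem_fixedSpace.1 hφ]
  refine ⟨fixedSpace P, hF, N, isClosed_fixedSpace P, ⟨a, b, ha, hb, hab⟩, hN, heig, ?_, ?_⟩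
  · obtain ⟨M, hM⟩ := hbdd
    refine ⟨b * M / a, fun s φ => ?_⟩
    have h1 : ‖restrictRep (dualRep T) (fixedSpace P) hF s φ‖ ≤ M * ‖φ‖ := by
      change ‖dualRep T s φ‖ ≤ M * ‖(φ : StrongDual ℂ E)‖
      rw [mul_comm]
      exact (ContinuousLinearMap.opNorm_comp_le (φ : StrongDual ℂ E) (T s)).trans
        (mul_le_mul_of_nonneg_left (hM s) (norm_nonneg _))
    have hM0 : 0 ≤ M := (norm_nonneg _).trans (hM 0)
    calc _ ≤ b * (M * ‖φ‖) := (hab _).2.trans (mul_le_mul_of_nonneg_left h1 hb.le)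
      _ = b * M / a * (a * ‖φ‖) := by field_simp
      _ ≤ _ := mul_le_mul_of_nonneg_left (hab φ).1 (by positivity)
  · intro s
    obtain ⟨Q, hQ, hQT, hTQ⟩ := hinv s
    -- The inverse is `PQ`: composing with `P` lands in `F`, and `P` is the identity there.
    let R : fixedSpace P →ₗ[ℂ] fixedSpace P :=
      toFixedSpace hidem ∘ₗ (Q : StrongDual ℂ E →ₗ[ℂ] StrongDual ℂ E) ∘ₗ (fixedSpace P).subtype
    have hRL : ∀ φ, R (restrictRep (dualRep T) (fixedSpace P) hF s φ) = φ := fun φ =>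
      Subtype.ext <| by
        change P (Q (dualRep T s φ)) = φ
        rw [hQT, hidem, mem_fixedSpace.1 φ.2]
    have hLR : ∀ φ, restrictRep (dualRep T) (fixedSpace P) hF s (R φ) = φ := fun φ =>
      Subtype.ext <| by
        change dualRep T s (P (Q φ)) = φ
        rw [← hcomm, hTQ, hidem, mem_fixedSpace.1 φ.2]
    have hL : ∀ φ ∈ inheritedCone (dualCone C) (fixedSpace P),
        restrictRep (dualRep T) (fixedSpace P) hF s φ ∈
          inheritedCone (dualCone C) (fixedSpace P) :=
      fun φ hφ x hx => hφ _ (hpos s x hx)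
    have hR : ∀ φ ∈ inheritedCone (dualCone C) (fixedSpace P),
        R φ ∈ inheritedCone (dualCone C) (fixedSpace P) := fun φ hφ => hP _ (hQ _ hφ)
    exact ⟨R, LinearMap.ext hLR, LinearMap.ext hRL,
      IsComplexVectorLattice.isLatticeHomomorphism_of_inverse hRL hLR hL hR,
      IsComplexVectorLattice.isLatticeHomomorphism_of_inverse hLR hRL hR hL⟩
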